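/- Arbitrary-connections sensor networks with an i.i.d. prior and heterogeneous sensors. Let $\mathcal V,\mathcal X,\mathcal Y$ be finite sets, let $P_V$ be a probability mass function on $\mathcal V$, and let $D\in[0,1]$. There are finitely many sensor classes $l$; a sensor of class $l$ has a range $c_l$, a sensing function $\Psi_l:\mathcal V^{c_l}\to\mathcal X$ and a noise model given by a conditional p.m.f. $P^{l}_{Y|X}$ from $\mathcal X$ to $\mathcal Y$. A network of $n$ sensors over $k$ target positions connects each sensor $\ell$, of class $l(\ell)$, to an ordered list of $c_{l(\ell)}$ positions (repetitions allowed). For a target vector $v\in\mathcal V^k$, sensor $\ell$ has ideal output $x_\ell(v)=\Psi_{l(\ell)}(\text{entries of }v\text{ at its positions})$, and the observed vector $y\in\mathcal Y^n$ has probability $\prod_\ell P^{l(\ell)}_{Y|X}(y_\ell|x_\ell(v))$. The entries of $v$ are i.i.d. with law $P_V$, and $v$ is detected from $y$ by a maximum a posteriori (MAP) detector $g$, that is, $g(y)$ maximizes the product of the prior and the likelihood over $\mathcal V^k$, with ties broken arbitrarily. An error occurs if $\frac1k d_H(v,g(y))\ge D$, where $d_H$ is the Hamming distance. For every $n$ let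 the classes of the $n$ sensors be prescribed so that, for each $l$, the fraction of sensors of class $l$ tends to $\alpha_l$ as $n\to\infty$. A rate $R>0$ is achievable if there is a sequence of networks of $n$ sensors of the prescribed classes over $\lceil nR\rceil$ positions whose error probability (averaged over $v$ and $y$) tends to $0$ as $n\to\infty$ for every choice of MAP detectors. The sensing capacity $C(D)\in[0,\infty]$ is the supremum of the $R\ge 0$ such that all rates in $(0,R)$ are achievable. For p.m.f.s $\gamma$ on $\mathcal V$ and $\lambda$ on $\mathcal V^2$ let $P^{\gamma,l}(x)=\sum_{u\in\mathcal V^{c_l}:\,\Psi_l(u)=x}\prod_t\gamma_{u_t}$ and $P^{\lambda,l}(x,x')=\sum_{u,u'\in\mathcal V^{c_l}:\,\Psi_l(u)=x,\,\Psi_l(u')=x'}\prod_t\lambda_{u_tu'_t}$, and put $$P^{\gamma,l}_{X_iY}(x,y)=P^{\gamma,l}(x)\,P^l_{Y|X}(y|x),\qquad Q^{\lambda,l}_{X_iY}(x,y)=\sum_{a\in\mathcal X}P^{\lambda,l}(x,a)\,P^l_{Y|X}(y|a).$$ Then $$C(D)\ \ge\ C_{LB}(D)=\min_{\lambda}\ \frac{\sum_l\alpha_l\,D\big(P^{\gamma_i,l}_{X_iY}\,\big\|\,Q^{\lambda,l}_{X_iY}\big)}{H(\lambda)-H(\gamma_j)-D(\gamma_j\|P_V)},$$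 where $\gamma_i=P_V$, $\gamma_j$ is the second marginal of $\lambda$, $\gamma_{jb}=\sum_a\lambda_{ab}$, $H$ is the entropy and $D(\cdot\|\cdot)\in[0,\infty]$ the Kullback-Leibler distance (base-2 logarithms), and the minimum (understood as an infimum, $+\infty$ if there is no such $\lambda$) is over the p.m.f.s $\lambda$ on $\mathcal V^2$ with $\sum_{a\ne b}\lambda_{ab}\ge D$, $\sum_b\lambda_{ab}=\gamma_{ia}$ for all $a$, and nonnegative denominator. Conventions: $0\cdot\infty=0$ in the numerator; if the denominator is $0$, the ratio is $+\infty$ for a positive numerator and $0$ for a zero numerator. -/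

import Mathlib

open Filter Topology
open scoped NNReal ENNReal

noncomputable section

namespace SensorNetwork

/-! ## Entropy and divergence of probability mass functions on finite sets, in bits -/

/-- Shannon entropy (base 2) of a p.m.f. on a finite set; `0 log 0 = 0`. -/
def entropy {A : Type*} [Fintype A] (p : A → ℝ) : ℝ :=
  -∑ a, p a * Real.logb 2 (p a)

open Classical in
/-- Kullback-Leibler distance (base 2) of two p.m.f.s on a finite set. It is `+∞` when `p` is not
absolutely continuous with respect to `q`. -/
def klDist {A : Type*} [Fintype A] (p q : A → ℝ) : ℝ≥0∞ :=
  if ∀ a, q a = 0 → p a = 0 then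
    ENNReal.ofReal (∑ a, p a * Real.logb 2 (p a / q a))
  else ⊤

/-! ## Sensors and sensor networks -/

/-- A class of sensors: its range `c`, its sensing function `Ψ : V^c → X` and its noise model, the
conditional p.m.f. `P_{Y|X}` (written `noise x y`). -/
structure SensorClass (V X Y : Type*) [Fintype Y] where
  range : ℕ
  sense : (Fin range → V) → X
  noise : X → Y → ℝ
  noise_mem : ∀ x, noise x ∈ stdSimplex ℝ Y

section Network

variable {V X Y L : Type*} [Fintype V] [DecidableEq V] [Fintype X] [DecidableEq X] [Fintype Y]

/-- A network of `n` sensors over `k` target positions, sensor `ℓ` being of class `cls ℓ`: each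
sensor is connected to as many positions (repetitions allowed) as its range says. -/
def Network (S : L → SensorClass V X Y) {n : ℕ} (cls : Fin n → L) (k : ℕ) : Type :=
  (ℓ : Fin n) → Fin (S (cls ℓ)).range → Fin k

/-- The noiseless output vector (codeword) of the network for the target vector `v`. -/
def idealOutput (S : L → SensorClass V X Y) {n k : ℕ} {cls : Fin n → L}
    (s : Network S cls k) (v : Fin k → V) : Fin n → X :=
  fun ℓ => (S (cls ℓ)).sense (fun t => v (s ℓ t))

/-- The probability of the noisy output vector `y` given that `v` occurred: the noise is
independent across sensors. -/
def likelihood (S : L → SensorClass V X Y) {n k : ℕ} {cls : Fin n → L}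
    (s : Network S cls k) (v : Fin k → V) (y : Fin n → Y) : ℝ :=
  ∏ ℓ, (S (cls ℓ)).noise (idealOutput S s v ℓ) (y ℓ)

/-- The probability of the target vector `v` when its entries are i.i.d. with p.m.f. `P`. -/
def priorProb (P : V → ℝ) {k : ℕ} (v : Fin k → V) : ℝ :=
  ∏ t, P (v t)

/-- `g` is a maximum a posteriori detector (ties are broken in any way). -/
def IsMAP (S : L → SensorClass V X Y) (P : V → ℝ) {n k : ℕ} {cls : Fin n → L}
    (s : Network S cls k) (g : (Fin n → Y) → (Fin k → V)) : Prop :=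
  ∀ y v, priorProb P v * likelihood S s v y ≤ priorProb P (g y) * likelihood S s (g y) y

/-- MAP detectors exist. -/
theorem exists_isMAP [Nonempty V] (S : L → SensorClass V X Y) (P : V → ℝ) {n k : ℕ}
    {cls : Fin n → L} (s : Network S cls k) :
    ∃ g : (Fin n → Y) → (Fin k → V), IsMAP S P s g := by
  have h : ∀ y : Fin n → Y, ∃ w : Fin k → V, ∀ v,
      priorProb P v * likelihood S s v y ≤ priorProb P w * likelihood S s w y :=
    fun y => Finite.exists_max (fun v => priorProb P v * likelihood S s v y)
  choose g hg using h
  exact ⟨g, hg⟩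

open Classical in
/-- The expected probability of error of the network `s` with the detector `g` at distortion `D`:
an error occurs when the true target vector `v` and the detected one differ in a fraction of the
positions that is not less than `D`. -/
def errorProb (S : L → SensorClass V X Y) (P : V → ℝ) (D : ℝ) {n k : ℕ} {cls : Fin n → L}
    (s : Network S cls k) (g : (Fin n → Y) → (Fin k → V)) : ℝ :=
  ∑ v : Fin k → V, priorProb P v *
    ∑ y : Fin n → Y, likelihood S s v y *
      (if (hammingDist v (g y) : ℝ) / k < D then 0 else 1)

/-- The rate `R` is achievable: there are networks of `n` sensors, of the prescribed classes
`cls n`, over `⌈n R⌉` target positions, whose expected probability of error under MAP detection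
tends to `0` as `n → ∞`. -/
def Achievable (S : L → SensorClass V X Y) (P : V → ℝ) (D : ℝ) (cls : (n : ℕ) → Fin n → L)
    (R : ℝ≥0) : Prop :=
  ∃ s : (n : ℕ) → Network S (cls n) ⌈(n : ℝ) * R⌉₊,
    ∀ g : (n : ℕ) → (Fin n → Y) → (Fin ⌈(n : ℝ) * R⌉₊ → V),
      (∀ n, IsMAP S P (s n) (g n)) →
        Tendsto (fun n => errorProb S P D (s n) (g n)) atTop (𝓝 0)

/-- The sensing capacity: the largest `R` such that all positive rates below `R` are achievable. -/
def sensingCapacity (S : L → SensorClass V X Y) (P : V → ℝ) (D : ℝ)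
    (cls : (n : ℕ) → Fin n → L) : ℝ≥0∞ :=
  ⨆ (R : ℝ≥0) (_ : ∀ R' : ℝ≥0, 0 < R' → R' < R → Achievable S P D cls R'), (R : ℝ≥0∞)

/-- Class `l` is used with (asymptotic) relative frequency `α l`. -/
def HasFrequencies [DecidableEq L] (cls : (n : ℕ) → Fin n → L) (α : L → ℝ≥0) : Prop :=
  ∀ l, Tendsto (fun n : ℕ => ((Finset.univ.filter fun ℓ => cls n ℓ = l).card : ℝ) / n)
    atTop (𝓝 (α l : ℝ))

/-! ## The single-sensor distributions and the lower bound -/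

/-- `P^γ(x)`: the p.m.f. of the ideal output of a sensor whose connections hit i.i.d. symbols with
p.m.f. `γ`, i.e. of a randomly connected sensor when the target vector has type `γ`. -/
def outputDist (C : SensorClass V X Y) (γ : V → ℝ) (x : X) : ℝ :=
  ∑ u : Fin C.range → V, if C.sense u = x then ∏ t, γ (u t) else 0

/-- `P^λ(x_i, x_j)`: the joint p.m.f. of the ideal outputs of one randomly connected sensor for two
target vectors of joint type `lam`. -/
def jointOutputDist (C : SensorClass V X Y) (lam : V × V → ℝ) (x x' : X) : ℝ :=
  ∑ w : Fin C.range → V × V,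
    if C.sense (fun t => (w t).1) = x ∧ C.sense (fun t => (w t).2) = x' then
      ∏ t, lam (w t) else 0

/-- `P_{X_i Y}^γ(x, y) = P^γ(x) P_{Y|X}(y|x)`. -/
def distP (C : SensorClass V X Y) (γ : V → ℝ) : X × Y → ℝ :=
  fun z => outputDist C γ z.1 * C.noise z.1 z.2

/-- `Q_{X_i Y}^λ(x, y) = ∑ a, P^λ(x, a) P_{Y|X}(y|a)`. -/
def distQ (C : SensorClass V X Y) (lam : V × V → ℝ) : X × Y → ℝ :=
  fun z => ∑ a, jointOutputDist C lam z.1 a * C.noise a z.2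

/-- The second marginal `γ_j` of `lam`. -/
def sndMarginal (lam : V × V → ℝ) : V → ℝ := fun b => ∑ a, lam (a, b)

/-- The feasible set: p.m.f.s on `V × V` with first marginal `P` and off-diagonal mass at
least `D`. -/
def feasible (P : V → ℝ) (D : ℝ) : Set (V × V → ℝ) :=
  {lam | lam ∈ stdSimplex ℝ (V × V) ∧ (∀ a, ∑ b, lam (a, b) = P a) ∧
    D ≤ ∑ a, ∑ b, if a ≠ b then lam (a, b) else 0}

/-- The numerator `∑ l, α l * D(P^{γ_i, l} ‖ Q^{λ, l})` with `γ_i = P`. -/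
def numerator [Fintype L] (S : L → SensorClass V X Y) (α : L → ℝ≥0) (P : V → ℝ)
    (lam : V × V → ℝ) : ℝ≥0∞ :=
  ∑ l, (α l : ℝ≥0∞) * klDist (distP (S l) P) (distQ (S l) lam)

/-- The denominator `H(λ) - H(γ_j) - D(γ_j ‖ P)`; it may be negative, or `-∞`. -/
def denominator (P : V → ℝ) (lam : V × V → ℝ) : EReal :=
  ((entropy lam - entropy (sndMarginal lam) : ℝ) : EReal)
    - (klDist (sndMarginal lam) P : EReal)

/-- The lower bound `C_LB(D)`: the least value of the ratio over the feasible `lam` with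
nonnegative denominator. In `ℝ≥0∞` one has `a / 0 = ∞` for `a > 0` and `0 / 0 = 0`. -/
def lowerBound [Fintype L] (S : L → SensorClass V X Y) (α : L → ℝ≥0) (P : V → ℝ) (D : ℝ) :
    ℝ≥0∞ :=
  ⨅ (lam : V × V → ℝ) (_ : lam ∈ feasible P D) (_ : 0 ≤ denominator P lam),
    numerator S α P lam / (denominator P lam).toENNReal

end Network

end SensorNetwork

end

/-!
Connect the sensors at random and bound the mean probability that some target vector at distortion
at least `D` is as probable as the true one, which every error of a MAP detector requires. Let a
sensor of class `l` with ideal output `x` and observation `y` contribute `f l (x, y)` to an additive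
score, and compare the score of the true vector with a threshold. For pairs of vectors of joint type
`λ` the exponential moments of the score factor over the sensors: when the observation comes from
the vector being scored they are governed by `distP`, when it comes from the other vector by
`distQ`. The sum over the other vectors, weighted by their prior, is controlled by a second function
`h`, of pairs of symbols. By the variational formula `D(p ‖ q) = sup_f (∑ p f - ∑ q exp f + 1)`,
some `f`, `h` and threshold make both exponents negative at `λ` as soon as the rate is below the
ratio in the bound.

Since cumulants are estimated by `log z ≤ z - 1`, the exponents for fixed `f` and `h` are continuous
in `λ`, even where divergences jump to infinity, so they stay negative on a neighbourhood of `λ`;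
compactness leaves finitely many neighbourhoods. Joint types whose first marginal is far from `P`
need no score: the type of the true vector concentrates at `P`.
-/

noncomputable section

namespace SensorNetwork

open scoped BigOperators Finset

section Empirical

variable {κ A : Type*} [Fintype κ] [DecidableEq A]

/-- The empirical distribution (type) of the word `w`; it is identically `0` for the empty word. -/
def empirical (w : κ → A) (a : A) : ℝ :=
  #{j | w j = a} / Fintype.card κ

theorem empirical_nonneg (w : κ → A) (a : A) : 0 ≤ empirical w a := by
  unfold empirical
  positivity

theorem empirical_comp {ι : Type*} [Fintype ι] [DecidableEq ι] (w : κ → A) (u : ι → A) :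
    empirical (fun σ : ι → κ => w ∘ σ) u = ∏ t, empirical w (u t) := by
  have hcard : #{σ : ι → κ | w ∘ σ = u} = ∏ t, #{j | w j = u t} := by
    rw [← Fintype.card_piFinset]
    congr 1
    ext σ
    simp [funext_iff]
  simp [empirical, hcard, Finset.prod_div_distrib]

variable [Fintype A]

theorem sum_empirical_mul (w : κ → A) (g : A → ℝ) :
    ∑ a, empirical w a * g a = 𝔼 j, g (w j) := by
  have hfiber : ∀ a, #{j | w j = a} * g a = ∑ j with w j = a, g (w j) := fun a => by
    rw [Finset.sum_congr rfl (g := fun _ => g a) fun j hj => by rw [(Finset.mem_filter.1 hj).2]]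
    simp
  simp_rw [Fintype.expect_eq_sum_div_card, empirical, div_mul_eq_mul_div, ← Finset.sum_div, hfiber,
    Finset.sum_fiberwise]

theorem card_mul_sum_empirical_mul (w : κ → A) (g : A → ℝ) :
    Fintype.card κ * ∑ a, empirical w a * g a = ∑ j, g (w j) := by
  rw [sum_empirical_mul, ← nsmul_eq_mul, Fintype.card_smul_expect]

theorem expect_comp_eq_sum_prod_empirical {ι : Type*} [Fintype ι] [DecidableEq ι] (w : κ → A)
    (φ : (ι → A) → ℝ) :
    𝔼 σ : ι → κ, φ (w ∘ σ) = ∑ u, (∏ t, empirical w (u t)) * φ u := by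
  simp_rw [← empirical_comp, sum_empirical_mul]

theorem empirical_mem_stdSimplex [Nonempty κ] (w : κ → A) : empirical w ∈ stdSimplex ℝ A :=
  ⟨empirical_nonneg w, by simpa using sum_empirical_mul w fun _ => 1⟩

theorem prod_comp_le_exp_empirical (w : κ → A) {b c : A → ℝ} (hb : ∀ a, 0 ≤ b a)
    (hbc : ∀ a, b a ≤ Real.exp (c a)) :
    ∏ j, b (w j) ≤ Real.exp (Fintype.card κ * ∑ a, empirical w a * c a) := by
  rw [card_mul_sum_empirical_mul, Real.exp_sum]
  exact Finset.prod_le_prod (fun j _ => hb _) fun j _ => hbc _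

end Empirical

section ExponentialMoments

variable {A : Type*} [Fintype A]

/-- The bound `z - 1 ≥ log z` for the cumulant `log z`, `z = ∑ a, q a * exp (f a)`. Unlike the
cumulant, it is affine in `q`. -/
def cumulantBound (q f : A → ℝ) : ℝ :=
  ∑ a, q a * Real.exp (f a) - 1

theorem sum_mul_exp_le_exp_cumulantBound (q f : A → ℝ) :
    ∑ a, q a * Real.exp (f a) ≤ Real.exp (cumulantBound q f) := by
  simpa [cumulantBound] using Real.add_one_le_exp (cumulantBound q f)

theorem cumulantBound_eq_sum {q : A → ℝ} (hq : ∑ a, q a = 1) (f : A → ℝ) :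
    cumulantBound q f = ∑ a, q a * (Real.exp (f a) - 1) := by
  simp_rw [mul_sub_one, Finset.sum_sub_distrib, hq, cumulantBound]

variable {κ : Type*} [Fintype κ] [DecidableEq κ]

theorem sum_prod_eq_pow (q : A → ℝ) :
    ∑ w : κ → A, ∏ t, q (w t) = (∑ a, q a) ^ Fintype.card κ := by
  rw [← Fintype.prod_sum fun (_ : κ) a => q a, Finset.prod_const, Finset.card_univ]

theorem sum_prod_mul_exp_le_one [DecidableEq A] {q : A → ℝ} (hq : ∀ a, 0 ≤ q a) (h : A → ℝ) :
    ∑ w : κ → A, (∏ t, q (w t)) *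
      Real.exp (Fintype.card κ * (∑ a, empirical w a * h a - cumulantBound q h)) ≤ 1 := by
  have hfactor : ∀ w : κ → A, (∏ t, q (w t)) *
      Real.exp (Fintype.card κ * (∑ a, empirical w a * h a - cumulantBound q h)) =
        (∏ t, q (w t) * Real.exp (h (w t))) * Real.exp (-cumulantBound q h) ^ Fintype.card κ := by
    intro w
    rw [mul_sub, card_mul_sum_empirical_mul, sub_eq_add_neg, Real.exp_add, Real.exp_sum, ← mul_neg,
      Real.exp_nat_mul, Finset.prod_mul_distrib, mul_assoc]
  calc _ = ((∑ a, q a * Real.exp (h a)) * Real.exp (-cumulantBound q h)) ^ Fintype.card κ := by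
        simp_rw [hfactor, ← Finset.sum_mul, sum_prod_eq_pow fun a => q a * Real.exp (h a), mul_pow]
    _ ≤ 1 := by
        refine pow_le_one₀ (mul_nonneg (Finset.sum_nonneg fun a _ =>
          mul_nonneg (hq a) (Real.exp_nonneg _)) (Real.exp_nonneg _)) ?_
        rw [Real.exp_neg, ← div_eq_mul_inv, div_le_one (Real.exp_pos _)]
        exact sum_mul_exp_le_exp_cumulantBound q h

theorem exists_pos_sum_mul_exp_sub_one_lt {q g : A → ℝ} {c : ℝ} (hc : ∑ a, q a * g a < c) :
    ∃ t > 0, ∑ a, q a * (Real.exp (t * g a) - 1) < t * c := by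
  have hderiv : HasDerivAt (fun t => ∑ a, q a * (Real.exp (t * g a) - 1)) (∑ a, q a * g a) 0 := by
    refine HasDerivAt.fun_sum fun a _ => (HasDerivAt.sub_const 1 ?_).const_mul (q a)
    simpa using ((hasDerivAt_id (0 : ℝ)).mul_const (g a)).exp
  have hslope := (hasDerivAt_iff_tendsto_slope.1 hderiv).mono_left
    (nhdsWithin_mono (0 : ℝ) (s := Set.Ioi 0) fun t ht => ne_of_gt ht)
  obtain ⟨t, ht, ht0 : 0 < t⟩ := ((hslope.eventually_lt_const hc).and self_mem_nhdsWithin).exists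
  refine ⟨t, ht0, ?_⟩
  simpa [slope_def_field, div_lt_iff₀ ht0, mul_comm c] using ht

theorem exists_cumulantBound_lt_of_ne {p γ : A → ℝ} (hp : ∑ a, p a = 1) (hne : γ ≠ p) :
    ∃ h : A → ℝ, cumulantBound p h < ∑ a, γ a * h a := by
  have hlt : ∑ a, p a * (γ a - p a) < ∑ a, γ a * (γ a - p a) := by
    rw [← sub_pos, ← Finset.sum_sub_distrib]
    simp_rw [← sub_mul]
    obtain ⟨a, ha⟩ := Function.ne_iff.1 hne
    exact Finset.sum_pos' (fun a _ => mul_self_nonneg _)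
      ⟨a, Finset.mem_univ a, mul_self_pos.2 (sub_ne_zero.2 ha)⟩
  obtain ⟨t, -, ht⟩ := exists_pos_sum_mul_exp_sub_one_lt hlt
  refine ⟨fun a => t * (γ a - p a), ?_⟩
  rw [cumulantBound_eq_sum hp]
  simpa only [Finset.mul_sum, mul_left_comm t] using ht

end ExponentialMoments

section Divergence

variable {A : Type*} [Fintype A]

/-- The Kullback-Leibler divergence in nats. The junk value of the quotient makes this formula
meaningful only when `p` is absolutely continuous with respect to `q`. -/
def klSum (p q : A → ℝ) : ℝ :=
  ∑ a, p a * Real.log (p a / q a)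

theorem klDist_eq_ofReal {p q : A → ℝ} (hac : ∀ a, q a = 0 → p a = 0) :
    klDist p q = ENNReal.ofReal (klSum p q / Real.log 2) := by
  simp_rw [klDist, if_pos hac, klSum, Finset.sum_div, Real.logb, mul_div_assoc]

theorem klSum_eq_sub {p q : A → ℝ} (hac : ∀ a, q a = 0 → p a = 0) :
    klSum p q = ∑ a, p a * Real.log (p a) - ∑ a, p a * Real.log (q a) := by
  rw [klSum, ← Finset.sum_sub_distrib]
  refine Finset.sum_congr rfl fun a _ => ?_
  rcases eq_or_ne (p a) 0 with hp | hp
  · simp [hp]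
  · rw [Real.log_div hp (mt (hac a) hp), mul_sub]

theorem klSum_nonneg {p q : A → ℝ} (hp : p ∈ stdSimplex ℝ A) (hq : q ∈ stdSimplex ℝ A)
    (hac : ∀ a, q a = 0 → p a = 0) : 0 ≤ klSum p q := by
  have hterm : ∀ a, p a - q a ≤ p a * Real.log (p a / q a) := fun a => by
    rcases eq_or_ne (q a) 0 with h0 | h0
    · simp [h0, hac a h0]
    · have hfun := InformationTheory.klFun_nonneg (div_nonneg (hp.1 a) (hq.1 a))
      have := mul_nonneg (hq.1 a) hfun
      rw [InformationTheory.klFun] at this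
      field_simp at this
      linarith
  calc 0 = ∑ a, (p a - q a) := by rw [Finset.sum_sub_distrib, hp.2, hq.2, sub_self]
    _ ≤ klSum p q := Finset.sum_le_sum fun a _ => hterm a

theorem exists_lt_sum_of_lt_klSum {p q : A → ℝ} (hp : ∀ a, 0 ≤ p a) (hq : ∀ a, 0 ≤ q a) {c : ℝ}
    (hc : (∀ a, q a = 0 → p a = 0) → c < klSum p q) :
    ∃ f : A → ℝ, c < ∑ a, (p a * f a - q a * Real.exp (f a) + p a) := by
  classical
  by_cases hac : ∀ a, q a = 0 → p a = 0
  · have hlim : ∀ a, Tendsto (fun M : ℝ => p a * (if p a = 0 then -M else Real.log (p a / q a)) -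
        q a * Real.exp (if p a = 0 then -M else Real.log (p a / q a)) + p a) atTop
        (𝓝 (p a * Real.log (p a / q a))) := by
      intro a
      rcases eq_or_ne (p a) 0 with h0 | h0
      · simpa [h0] using (Real.tendsto_exp_neg_atTop_nhds_zero.const_mul (q a)).neg
      · have hq0 : q a ≠ 0 := mt (hac a) h0
        have hpos : 0 < p a / q a := div_pos ((hp a).lt_of_ne' h0) ((hq a).lt_of_ne' hq0)
        simp [h0, Real.exp_log hpos, mul_div_cancel₀ _ hq0]
    obtain ⟨M, hM⟩ :=
      ((tendsto_finsetSum _ fun a _ => hlim a).eventually_const_lt (hc hac)).exists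
    exact ⟨_, hM⟩
  · push Not at hac
    obtain ⟨a₀, hq₀, hp₀⟩ := hac
    have hlin : Tendsto (fun M : ℝ => p a₀ * M + ∑ a, (p a - q a)) atTop atTop :=
      tendsto_atTop_add_const_right _ _ (tendsto_id.const_mul_atTop ((hp a₀).lt_of_ne' hp₀))
    obtain ⟨M, hM⟩ := (hlin.eventually_gt_atTop c).exists
    refine ⟨Pi.single a₀ M, hM.trans_eq ?_⟩
    have hexp : ∀ a, q a * Real.exp ((Pi.single a₀ M : A → ℝ) a) = q a := fun a => by
      rcases eq_or_ne a a₀ with rfl | ha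
      · simp [hq₀]
      · simp [ha]
    simp_rw [hexp, sub_add_eq_add_sub, add_sub_assoc, Finset.sum_add_distrib]
    simp [Pi.single_apply]

end Divergence

section Marginals

variable {V : Type*} [Fintype V]

/-- The first marginal `γ_i` of `lam`. -/
def fstMarginal (lam : V × V → ℝ) (a : V) : ℝ :=
  ∑ b, lam (a, b)

theorem sndMarginal_mem_stdSimplex {lam : V × V → ℝ} (hlam : lam ∈ stdSimplex ℝ (V × V)) :
    sndMarginal lam ∈ stdSimplex ℝ V :=
  ⟨fun _ => Finset.sum_nonneg fun _ _ => hlam.1 _, by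
    rw [← hlam.2, Fintype.sum_prod_type_right]
    rfl⟩

variable [DecidableEq V] {κ : Type*} [Fintype κ]

/-- The joint type of two target vectors. -/
def jointType (v v' : κ → V) : V × V → ℝ :=
  empirical fun t => (v t, v' t)

theorem fstMarginal_jointType (v v' : κ → V) : fstMarginal (jointType v v') = empirical v := by
  ext a
  have hpair := sum_empirical_mul (fun t => (v t, v' t)) fun ab => if ab.1 = a then 1 else 0
  have hsingle := sum_empirical_mul v fun b => if b = a then 1 else 0
  rw [← hsingle, Fintype.sum_prod_type_right] at hpair
  simpa [fstMarginal, jointType] using hpair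

end Marginals

section SingleSensor

variable {V X Y : Type*} [Fintype V] [Fintype X] [DecidableEq X] [Fintype Y]

theorem sum_distP_mul (C : SensorClass V X Y) (γ : V → ℝ) (g : X × Y → ℝ) :
    ∑ z, distP C γ z * g z =
      ∑ u, (∏ t, γ (u t)) * ∑ y, C.noise (C.sense u) y * g (C.sense u, y) := by
  have hword : ∀ u : Fin C.range → V,
      (∏ t, γ (u t)) * ∑ y, C.noise (C.sense u) y * g (C.sense u, y) =
        ∑ z : X × Y, (if C.sense u = z.1 then ∏ t, γ (u t) else 0) * C.noise z.1 z.2 * g z :=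
    fun u => by
      rw [Fintype.sum_prod_type_right, Finset.mul_sum]
      exact Finset.sum_congr rfl fun y _ => by simp [mul_assoc]
  simp_rw [hword]
  rw [Finset.sum_comm]
  simp_rw [distP, outputDist, Finset.sum_mul]

theorem sum_distQ_mul (C : SensorClass V X Y) (lam : V × V → ℝ) (g : X × Y → ℝ) :
    ∑ z, distQ C lam z * g z = ∑ w : Fin C.range → V × V, (∏ t, lam (w t)) *
      ∑ y, C.noise (C.sense fun t => (w t).2) y * g (C.sense fun t => (w t).1, y) := by
  have hword : ∀ w : Fin C.range → V × V, (∏ t, lam (w t)) *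
      ∑ y, C.noise (C.sense fun t => (w t).2) y * g (C.sense fun t => (w t).1, y) =
        ∑ z : X × Y, ∑ a,
          (if C.sense (fun t => (w t).1) = z.1 ∧ C.sense (fun t => (w t).2) = a then
            ∏ t, lam (w t) else 0) * C.noise a z.2 * g z := fun w => by
    rw [Fintype.sum_prod_type_right, Finset.mul_sum]
    exact Finset.sum_congr rfl fun y _ => by simp [ite_and, mul_assoc]
  simp_rw [hword]
  rw [Finset.sum_comm]
  refine Finset.sum_congr rfl fun z _ => ?_
  rw [Finset.sum_comm]
  simp_rw [distQ, jointOutputDist, Finset.sum_mul]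

theorem distQ_nonneg (C : SensorClass V X Y) {lam : V × V → ℝ} (hlam : ∀ ab, 0 ≤ lam ab)
    (z : X × Y) : 0 ≤ distQ C lam z :=
  Finset.sum_nonneg fun a _ => mul_nonneg
    (Finset.sum_nonneg fun _ _ => ite_nonneg (Finset.prod_nonneg fun _ _ => hlam _) le_rfl)
    ((C.noise_mem a).1 z.2)

theorem distP_mem_stdSimplex (C : SensorClass V X Y) {γ : V → ℝ} (hγ : γ ∈ stdSimplex ℝ V) :
    distP C γ ∈ stdSimplex ℝ (X × Y) :=
  ⟨fun z => mul_nonneg (Finset.sum_nonneg fun _ _ =>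
    ite_nonneg (Finset.prod_nonneg fun _ _ => hγ.1 _) le_rfl) ((C.noise_mem z.1).1 z.2), by
    simpa [(C.noise_mem _).2, sum_prod_eq_pow, hγ.2] using sum_distP_mul C γ fun _ => 1⟩

theorem distQ_mem_stdSimplex (C : SensorClass V X Y) {lam : V × V → ℝ}
    (hlam : lam ∈ stdSimplex ℝ (V × V)) : distQ C lam ∈ stdSimplex ℝ (X × Y) :=
  ⟨distQ_nonneg C hlam.1, by
    simpa [(C.noise_mem _).2, sum_prod_eq_pow, hlam.2] using sum_distQ_mul C lam fun _ => 1⟩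

theorem continuous_cumulantBound_distP (C : SensorClass V X Y) (f : X × Y → ℝ) :
    Continuous fun γ => cumulantBound (distP C γ) f := by
  simp_rw [cumulantBound, sum_distP_mul]
  fun_prop

theorem continuous_cumulantBound_distQ (C : SensorClass V X Y) (f : X × Y → ℝ) :
    Continuous fun lam => cumulantBound (distQ C lam) f := by
  simp_rw [cumulantBound, sum_distQ_mul]
  fun_prop

variable [DecidableEq V] {κ : Type*} [Fintype κ]

theorem expect_noise_eq_sum_distP (C : SensorClass V X Y) (v : κ → V) (g : X × Y → ℝ) :
    𝔼 σ : Fin C.range → κ, ∑ y, C.noise (C.sense (v ∘ σ)) y * g (C.sense (v ∘ σ), y) =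
      ∑ z, distP C (empirical v) z * g z := by
  rw [sum_distP_mul]
  exact expect_comp_eq_sum_prod_empirical v
    fun u => ∑ y, C.noise (C.sense u) y * g (C.sense u, y)

theorem expect_noise_eq_sum_distQ (C : SensorClass V X Y) (v v' : κ → V) (g : X × Y → ℝ) :
    𝔼 σ : Fin C.range → κ, ∑ y, C.noise (C.sense (v' ∘ σ)) y * g (C.sense (v ∘ σ), y) =
      ∑ z, distQ C (jointType v v') z * g z := by
  rw [sum_distQ_mul]
  exact expect_comp_eq_sum_prod_empirical (fun t => (v t, v' t)) fun w =>
    ∑ y, C.noise (C.sense fun t => (w t).2) y * g (C.sense fun t => (w t).1, y)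

theorem distQ_jointType_self (C : SensorClass V X Y) (v : κ → V) :
    distQ C (jointType v v) = distP C (empirical v) := by
  classical
  ext z
  have hsum := (expect_noise_eq_sum_distQ C v v (Pi.single z 1)).symm.trans
    (expect_noise_eq_sum_distP C v _)
  simpa [Pi.single_apply] using hsum

end SingleSensor

section RandomNetwork

variable {V X Y L : Type*} [Fintype Y] {n k : ℕ} {cls : Fin n → L}

instance (S : L → SensorClass V X Y) (cls : Fin n → L) (k : ℕ) : Fintype (Network S cls k) :=
  inferInstanceAs (Fintype ((ℓ : Fin n) → Fin (S (cls ℓ)).range → Fin k))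

theorem expect_network_sum_prod (S : L → SensorClass V X Y)
    (Φ : (ℓ : Fin n) → (Fin (S (cls ℓ)).range → Fin k) → Y → ℝ) :
    𝔼 s : Network S cls k, ∑ y : Fin n → Y, ∏ ℓ, Φ ℓ (s ℓ) (y ℓ) =
      ∏ ℓ, 𝔼 σ, ∑ y, Φ ℓ σ y := by
  simp_rw [← Fintype.prod_sum, Fintype.expect_eq_sum_div_card, Finset.prod_div_distrib]
  rw [← Nat.cast_prod, ← Fintype.card_pi, Fintype.prod_sum]
  rfl

/-- The additive score of the target vector `v` for the observation `y`: sensor `ℓ` contributes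
`f (cls ℓ)` at its ideal output for `v` and its observation. The random-coding argument tests `v`
by comparing its score with a threshold. -/
def score (S : L → SensorClass V X Y) (f : L → X × Y → ℝ) (s : Network S cls k) (v : Fin k → V)
    (y : Fin n → Y) : ℝ :=
  ∑ ℓ, f (cls ℓ) (idealOutput S s v ℓ, y ℓ)

theorem score_const_mul (S : L → SensorClass V X Y) (c : ℝ) (f : L → X × Y → ℝ)
    (s : Network S cls k) (v : Fin k → V) (y : Fin n → Y) :
    score S (fun l z => c * f l z) s v y = c * score S f s v y :=
  (Finset.mul_sum ..).symm

theorem expect_likelihood_mul_exp_score_le [Fintype V] [Fintype X] [DecidableEq V] [DecidableEq X]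
    [Fintype L] [DecidableEq L] (S : L → SensorClass V X Y) (f : L → X × Y → ℝ)
    (v v' : Fin k → V) :
    𝔼 s : Network S cls k, ∑ y, likelihood S s v' y * Real.exp (score S f s v y) ≤
      Real.exp (n * ∑ l, empirical cls l * cumulantBound (distQ (S l) (jointType v v')) (f l)) := by
  simp_rw [score, Real.exp_sum, likelihood, ← Finset.prod_mul_distrib]
  refine (expect_network_sum_prod S fun ℓ σ y => (S (cls ℓ)).noise ((S (cls ℓ)).sense (v' ∘ σ)) y *
    Real.exp (f (cls ℓ) ((S (cls ℓ)).sense (v ∘ σ), y))).trans_le ?_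
  simp_rw [fun ℓ => expect_noise_eq_sum_distQ (S (cls ℓ)) v v' fun z => Real.exp (f (cls ℓ) z)]
  have hprod := prod_comp_le_exp_empirical cls
    (fun l => Finset.sum_nonneg fun z _ => mul_nonneg
      (distQ_nonneg (S l) (empirical_nonneg fun t => (v t, v' t)) z) (Real.exp_nonneg (f l z)))
    fun l => sum_mul_exp_le_exp_cumulantBound (distQ (S l) (jointType v v')) (f l)
  rwa [Fintype.card_fin] at hprod

end RandomNetwork

section Confusion

variable {V X Y L : Type*} [Fintype Y] {n k : ℕ} {cls : Fin n → L}

theorem likelihood_nonneg (S : L → SensorClass V X Y) (s : Network S cls k) (v : Fin k → V)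
    (y : Fin n → Y) : 0 ≤ likelihood S s v y :=
  Finset.prod_nonneg fun ℓ _ => ((S (cls ℓ)).noise_mem _).1 _

theorem sum_likelihood (S : L → SensorClass V X Y) (s : Network S cls k) (v : Fin k → V) :
    ∑ y, likelihood S s v y = 1 := by
  simp_rw [likelihood]
  rw [← Fintype.prod_sum fun ℓ => (S (cls ℓ)).noise (idealOutput S s v ℓ)]
  exact Finset.prod_eq_one fun ℓ _ => ((S (cls ℓ)).noise_mem _).2

theorem priorProb_nonneg {P : V → ℝ} (hP : ∀ a, 0 ≤ P a) (v : Fin k → V) : 0 ≤ priorProb P v :=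
  Finset.prod_nonneg fun _ _ => hP _

/-- The joint probability of the target vector `v` and the observation `y`; as a function of `v`
it is proportional to the posterior that a MAP detector maximizes. -/
def jointProb (S : L → SensorClass V X Y) (P : V → ℝ) (s : Network S cls k) (v : Fin k → V)
    (y : Fin n → Y) : ℝ :=
  priorProb P v * likelihood S s v y

theorem jointProb_nonneg (S : L → SensorClass V X Y) {P : V → ℝ} (hP : ∀ a, 0 ≤ P a)
    (s : Network S cls k) (v : Fin k → V) (y : Fin n → Y) : 0 ≤ jointProb S P s v y :=
  mul_nonneg (priorProb_nonneg hP v) (likelihood_nonneg S s v y)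

variable [DecidableEq V]

/-- Under the observation `y`, some target vector whose joint type with the true one `v` lies in
`U` is at least as probable as `v`. -/
def IsConfusable (S : L → SensorClass V X Y) (P : V → ℝ) (s : Network S cls k)
    (U : Set (V × V → ℝ)) (v : Fin k → V) (y : Fin n → Y) : Prop :=
  ∃ v', jointType v v' ∈ U ∧ jointProb S P s v y ≤ jointProb S P s v' y

variable [Fintype V]

open Classical in
/-- The probability that the true target vector is confusable. For `U` the joint types at
distortion at least `D` it dominates the error probability of every MAP detector. -/
def confusionProb (S : L → SensorClass V X Y) (P : V → ℝ) (s : Network S cls k)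
    (U : Set (V × V → ℝ)) : ℝ :=
  ∑ v, ∑ y, if IsConfusable S P s U v y then jointProb S P s v y else 0

/-- The average of `confusionProb` over all networks, that is, its mean for uniformly random
connections. -/
def meanConfusionProb (S : L → SensorClass V X Y) (P : V → ℝ) (cls : Fin n → L) (k : ℕ)
    (U : Set (V × V → ℝ)) : ℝ :=
  𝔼 s : Network S cls k, confusionProb S P s U

theorem confusionProb_nonneg (S : L → SensorClass V X Y) {P : V → ℝ} (hP : ∀ a, 0 ≤ P a)
    (s : Network S cls k) (U : Set (V × V → ℝ)) : 0 ≤ confusionProb S P s U :=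
  Finset.sum_nonneg fun v _ => Finset.sum_nonneg fun y _ =>
    by split_ifs <;> simp [jointProb_nonneg S hP s v y]

theorem meanConfusionProb_nonneg (S : L → SensorClass V X Y) {P : V → ℝ} (hP : ∀ a, 0 ≤ P a)
    (cls : Fin n → L) (k : ℕ) (U : Set (V × V → ℝ)) : 0 ≤ meanConfusionProb S P cls k U :=
  Finset.expect_nonneg fun s _ => confusionProb_nonneg S hP s U

theorem meanConfusionProb_empty (S : L → SensorClass V X Y) (P : V → ℝ) (cls : Fin n → L)
    (k : ℕ) : meanConfusionProb S P cls k ∅ = 0 := by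
  simp [meanConfusionProb, confusionProb, IsConfusable]

theorem meanConfusionProb_union_le (S : L → SensorClass V X Y) {P : V → ℝ} (hP : ∀ a, 0 ≤ P a)
    (cls : Fin n → L) (k : ℕ) (U U' : Set (V × V → ℝ)) :
    meanConfusionProb S P cls k (U ∪ U') ≤
      meanConfusionProb S P cls k U + meanConfusionProb S P cls k U' := by
  have hunion : ∀ (s : Network S cls k) v y, IsConfusable S P s (U ∪ U') v y ↔
      IsConfusable S P s U v y ∨ IsConfusable S P s U' v y := fun s v y => by
    simp only [IsConfusable, Set.mem_union, or_and_right, exists_or]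
  simp only [meanConfusionProb, confusionProb, ← Finset.expect_add_distrib,
    ← Finset.sum_add_distrib, hunion]
  refine Finset.expect_le_expect fun s _ => Finset.sum_le_sum fun v _ =>
    Finset.sum_le_sum fun y _ => ?_
  have := jointProb_nonneg S hP s v y
  split_ifs <;> simp_all

theorem meanConfusionProb_mono (S : L → SensorClass V X Y) {P : V → ℝ} (hP : ∀ a, 0 ≤ P a)
    (cls : Fin n → L) (k : ℕ) {U U' : Set (V × V → ℝ)} (hU : U ⊆ U') :
    meanConfusionProb S P cls k U ≤ meanConfusionProb S P cls k U' := by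
  refine Finset.expect_le_expect fun s _ => Finset.sum_le_sum fun v _ =>
    Finset.sum_le_sum fun y _ => ?_
  have hmono : IsConfusable S P s U v y → IsConfusable S P s U' v y :=
    fun ⟨v', hv', hle⟩ => ⟨v', hU hv', hle⟩
  have := jointProb_nonneg S hP s v y
  split_ifs <;> simp_all

open Classical in
theorem confusionProb_le_sum_priorProb (S : L → SensorClass V X Y) {P : V → ℝ}
    (hP : ∀ a, 0 ≤ P a) (s : Network S cls k) (U : Set (V × V → ℝ)) :
    confusionProb S P s U ≤
      ∑ v : Fin k → V with ∃ v', jointType v v' ∈ U, priorProb P v := by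
  rw [Finset.sum_filter]
  refine Finset.sum_le_sum fun v _ => ?_
  split_ifs with hv
  · calc _ ≤ ∑ y, jointProb S P s v y := Finset.sum_le_sum fun y _ => by
          split_ifs
          exacts [le_rfl, jointProb_nonneg S hP s v y]
      _ = priorProb P v := by simp_rw [jointProb, ← Finset.mul_sum, sum_likelihood, mul_one]
  · exact (Finset.sum_eq_zero fun y _ => if_neg fun ⟨v', hv', _⟩ => hv ⟨v', hv'⟩).le

theorem confusionProb_le_exp_of_fstMarginal (S : L → SensorClass V X Y) {P : V → ℝ}
    (hP : ∀ a, 0 ≤ P a) (s : Network S cls k) {U : Set (V × V → ℝ)} {h : V → ℝ} {δ : ℝ}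
    (hU : ∀ lam ∈ U, cumulantBound P h - ∑ a, fstMarginal lam a * h a ≤ -δ) :
    confusionProb S P s U ≤ Real.exp (-(k * δ)) := by
  classical
  refine (confusionProb_le_sum_priorProb S hP s U).trans ?_
  have hmass := sum_prod_mul_exp_le_one (κ := Fin k) hP h
  rw [Fintype.card_fin] at hmass
  calc _ ≤ ∑ v : Fin k → V, Real.exp (-(k * δ)) * ((∏ t, P (v t)) *
        Real.exp (k * (∑ a, empirical v a * h a - cumulantBound P h))) := by
        refine (Finset.sum_le_sum fun v hv => ?_).trans (Finset.sum_le_sum_of_subset_of_nonneg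
          (Finset.filter_subset _ _) fun v _ _ => ?_)
        · obtain ⟨v', hv'⟩ := (Finset.mem_filter.1 hv).2
          have hexp := hU _ hv'
          rw [fstMarginal_jointType] at hexp
          rw [mul_left_comm, ← Real.exp_add]
          refine le_mul_of_one_le_right (priorProb_nonneg hP v) (Real.one_le_exp ?_)
          linear_combination (k : ℝ) * hexp
        · exact mul_nonneg (Real.exp_nonneg _)
            (mul_nonneg (priorProb_nonneg hP v) (Real.exp_nonneg _))
    _ ≤ Real.exp (-(k * δ)) := by
        rw [← Finset.mul_sum]
        exact mul_le_of_le_one_right (Real.exp_nonneg _) hmass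

/-- The distributions on `V × V` with off-diagonal mass at least `D`: the joint types of the pairs
of vectors at normalized Hamming distance at least `D` lie in it. -/
def offDiagSet (V : Type*) [Fintype V] [DecidableEq V] (D : ℝ) : Set (V × V → ℝ) :=
  stdSimplex ℝ (V × V) ∩ {lam | D ≤ ∑ a, ∑ b, if a ≠ b then lam (a, b) else 0}

theorem isCompact_offDiagSet (D : ℝ) : IsCompact (offDiagSet V D) := by
  refine (isCompact_stdSimplex ℝ (V × V)).inter_right (isClosed_le continuous_const ?_)
  refine continuous_finsetSum _ fun a _ => continuous_finsetSum _ fun b _ => ?_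
  split_ifs <;> fun_prop

theorem jointType_mem_offDiagSet (hk : k ≠ 0) {v v' : Fin k → V} {D : ℝ}
    (hD : D ≤ (hammingDist v v' : ℝ) / k) : jointType v v' ∈ offDiagSet V D := by
  have : NeZero k := ⟨hk⟩
  refine ⟨empirical_mem_stdSimplex _, hD.trans_eq ?_⟩
  have hoff := sum_empirical_mul (fun t => (v t, v' t)) fun ab => if ab.1 ≠ ab.2 then 1 else 0
  rw [Fintype.sum_prod_type, Fintype.expect_eq_sum_div_card, Finset.sum_boole,
    Fintype.card_fin] at hoff
  simpa only [mul_ite, mul_one, mul_zero, jointType, hammingDist] using hoff.symm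

theorem errorProb_nonneg (S : L → SensorClass V X Y) {P : V → ℝ} (hP : ∀ a, 0 ≤ P a) (D : ℝ)
    (s : Network S cls k) (g : (Fin n → Y) → (Fin k → V)) :
    0 ≤ errorProb S P D s g :=
  Finset.sum_nonneg fun v _ => mul_nonneg (priorProb_nonneg hP v) <| Finset.sum_nonneg fun y _ =>
    mul_nonneg (likelihood_nonneg S s v y) (ite_nonneg le_rfl zero_le_one)

theorem errorProb_le_confusionProb (S : L → SensorClass V X Y) {P : V → ℝ}
    (hP : ∀ a, 0 ≤ P a) (D : ℝ) (hk : k ≠ 0) (s : Network S cls k)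
    {g : (Fin n → Y) → (Fin k → V)} (hg : IsMAP S P s g) :
    errorProb S P D s g ≤ confusionProb S P s (offDiagSet V D) := by
  classical
  simp_rw [errorProb, Finset.mul_sum, ← mul_assoc]
  refine Finset.sum_le_sum fun v _ => Finset.sum_le_sum fun y _ => ?_
  by_cases herror : (hammingDist v (g y) : ℝ) / k < D
  · rw [if_pos herror, mul_zero]
    exact ite_nonneg (jointProb_nonneg S hP s v y) le_rfl
  · have hconf : IsConfusable S P s (offDiagSet V D) v y :=
      ⟨g y, jointType_mem_offDiagSet hk (not_lt.1 herror), hg y v⟩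
    rw [if_neg herror, if_pos hconf, mul_one, jointProb]

end Confusion

section RandomCoding

variable {V X Y L : Type*} [Fintype V] [DecidableEq V] {n k : ℕ} {cls : Fin n → L}

theorem sum_priorProb_snd_mul_exp_le_one {P : V → ℝ} (hP : ∀ a, 0 ≤ P a) (h : V × V → ℝ) :
    ∑ v : Fin k → V, ∑ v' : Fin k → V, priorProb P v' *
      Real.exp (k * (∑ ab, jointType v v' ab * h ab - cumulantBound (fun ab => P ab.2) h)) ≤ 1 := by
  have hpairs := sum_prod_mul_exp_le_one (κ := Fin k) (q := fun ab : V × V => P ab.2)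
    (fun ab => hP ab.2) h
  rw [Fintype.card_fin] at hpairs
  rwa [← Fintype.sum_prod_type', ← (Equiv.arrowProdEquivProdArrow (Fin k) (fun _ => V)
    fun _ => V).sum_comp]

variable [Fintype Y]

open Classical in
/-- Threshold decoding: a true vector scoring at least `τ` is overtaken only by one whose joint
probability gains the factor `exp (score - τ) ≥ 1`; otherwise `exp (t * (τ - score)) ≥ 1`. -/
theorem jointProb_le_score_of_isConfusable (S : L → SensorClass V X Y) {P : V → ℝ}
    (hP : ∀ a, 0 ≤ P a) {s : Network S cls k} {U : Set (V × V → ℝ)} {v : Fin k → V} {y : Fin n → Y}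
    (hconf : IsConfusable S P s U v y) (f : L → X × Y → ℝ) (τ : ℝ) {t : ℝ} (ht : 0 ≤ t) :
    jointProb S P s v y ≤ jointProb S P s v y * Real.exp (t * (τ - score S f s v y)) +
      ∑ v', if jointType v v' ∈ U then
        jointProb S P s v' y * Real.exp (score S f s v y - τ) else 0 := by
  have hnonneg : ∀ v' ∈ Finset.univ, 0 ≤ if jointType v v' ∈ U then
      jointProb S P s v' y * Real.exp (score S f s v y - τ) else 0 := fun v' _ =>
    ite_nonneg (mul_nonneg (jointProb_nonneg S hP s v' y) (Real.exp_nonneg _)) le_rfl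
  obtain ⟨v', hv', hle⟩ := hconf
  rcases le_total (score S f s v y) τ with hτ | hτ
  · refine le_add_of_le_of_nonneg ?_ (Finset.sum_nonneg hnonneg)
    exact le_mul_of_one_le_right (jointProb_nonneg S hP s v y)
      (Real.one_le_exp (mul_nonneg ht (sub_nonneg.2 hτ)))
  · refine le_add_of_nonneg_of_le
      (mul_nonneg (jointProb_nonneg S hP s v y) (Real.exp_nonneg _)) ?_
    refine le_trans ?_ (Finset.single_le_sum hnonneg (Finset.mem_univ v'))
    rw [if_pos hv']
    exact hle.trans (le_mul_of_one_le_right (jointProb_nonneg S hP s v' y)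
      (Real.one_le_exp (sub_nonneg.2 hτ)))

open Classical in
theorem confusionProb_le_score (S : L → SensorClass V X Y) {P : V → ℝ} (hP : ∀ a, 0 ≤ P a)
    (s : Network S cls k) (U : Set (V × V → ℝ)) (f : L → X × Y → ℝ) (τ : ℝ) {t : ℝ} (ht : 0 ≤ t) :
    confusionProb S P s U ≤
      ∑ v, (if ∃ v', jointType v v' ∈ U then
        ∑ y, jointProb S P s v y * Real.exp (t * (τ - score S f s v y)) else 0) +
      ∑ v, ∑ v', if jointType v v' ∈ U then
        ∑ y, jointProb S P s v' y * Real.exp (score S f s v y - τ) else 0 := by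
  rw [← Finset.sum_add_distrib]
  refine Finset.sum_le_sum fun v _ => ?_
  by_cases hU : ∃ v', jointType v v' ∈ U
  · have hcomm : ∑ v', (if jointType v v' ∈ U then
        ∑ y, jointProb S P s v' y * Real.exp (score S f s v y - τ) else 0) =
        ∑ y, ∑ v', if jointType v v' ∈ U then
          jointProb S P s v' y * Real.exp (score S f s v y - τ) else 0 := by
      rw [Finset.sum_comm]
      simp_rw [Finset.sum_ite_irrel, Finset.sum_const_zero]
    rw [if_pos hU, hcomm, ← Finset.sum_add_distrib]
    refine Finset.sum_le_sum fun y _ => ?_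
    split_ifs with hconf
    · exact jointProb_le_score_of_isConfusable S hP hconf f τ ht
    · exact add_nonneg (mul_nonneg (jointProb_nonneg S hP s v y) (Real.exp_nonneg _))
        (Finset.sum_nonneg fun v' _ => ite_nonneg
          (mul_nonneg (jointProb_nonneg S hP s v' y) (Real.exp_nonneg _)) le_rfl)
  · have hconf : ∀ y, ¬IsConfusable S P s U v y := fun y ⟨v', hv', _⟩ => hU ⟨v', hv'⟩
    simp_all

variable [Fintype X] [DecidableEq X] [Fintype L] [DecidableEq L]

theorem expect_jointProb_mul_exp_score_le (S : L → SensorClass V X Y) {P : V → ℝ}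
    (hP : ∀ a, 0 ≤ P a) (f : L → X × Y → ℝ) (c : ℝ) (v v' : Fin k → V) :
    𝔼 s : Network S cls k, ∑ y, jointProb S P s v' y * Real.exp (score S f s v y + c) ≤
      priorProb P v' * Real.exp (n * ∑ l, empirical cls l *
        cumulantBound (distQ (S l) (jointType v v')) (f l) + c) := by
  have hfactor : 𝔼 s : Network S cls k,
      ∑ y, jointProb S P s v' y * Real.exp (score S f s v y + c) = priorProb P v' *
        ((𝔼 s : Network S cls k, ∑ y, likelihood S s v' y * Real.exp (score S f s v y)) *
          Real.exp c) := by
    simp_rw [Finset.expect_mul, Finset.mul_expect, Finset.sum_mul, Finset.mul_sum, jointProb,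
      Real.exp_add, mul_assoc]
  rw [hfactor, Real.exp_add]
  exact mul_le_mul_of_nonneg_left (mul_le_mul_of_nonneg_right
    (expect_likelihood_mul_exp_score_le S f v v') (Real.exp_nonneg c)) (priorProb_nonneg hP v')

open Classical in
theorem expect_true_score_le_exp (S : L → SensorClass V X Y) {P : V → ℝ}
    (hP : P ∈ stdSimplex ℝ V) {U : Set (V × V → ℝ)} {f : L → X × Y → ℝ} {θ t δ : ℝ}
    (hU : ∀ lam ∈ U, ∑ l, empirical cls l *
      cumulantBound (distP (S l) (fstMarginal lam)) (fun z => -t * f l z) + t * θ ≤ -δ) :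
    𝔼 s : Network S cls k, ∑ v, (if ∃ v', jointType v v' ∈ U then
        ∑ y, jointProb S P s v y * Real.exp (t * (n * θ - score S f s v y)) else 0) ≤
      Real.exp (-(n * δ)) := by
  have hscore : ∀ s : Network S cls k, ∀ v y, t * (n * θ - score S f s v y) =
      score S (fun l z => -t * f l z) s v y + n * (t * θ) := fun s v y => by
    rw [score_const_mul]
    ring
  calc _ ≤ ∑ v : Fin k → V, priorProb P v * Real.exp (-(n * δ)) := by
        rw [Finset.expect_sum_comm]
        refine Finset.sum_le_sum fun v _ => ?_
        split_ifs with hv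
        · obtain ⟨v', hv'⟩ := hv
          have hδ := hU _ hv'
          simp_rw [fstMarginal_jointType, ← distQ_jointType_self] at hδ
          simp_rw [hscore]
          refine (expect_jointProb_mul_exp_score_le S hP.1 _ _ v v).trans ?_
          refine mul_le_mul_of_nonneg_left (Real.exp_le_exp.2 ?_) (priorProb_nonneg hP.1 v)
          linear_combination (n : ℝ) * hδ
        · simpa using mul_nonneg (priorProb_nonneg hP.1 v) (Real.exp_nonneg _)
    _ = Real.exp (-(n * δ)) := by
        simp_rw [← Finset.sum_mul, priorProb, sum_prod_eq_pow, hP.2, one_pow, one_mul]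

open Classical in
/-- Tilting the prior of the false vectors by `h` bounds the total prior mass of those of a given
joint type, which refines the plain union bound. -/
theorem expect_false_score_le_exp (S : L → SensorClass V X Y) {P : V → ℝ} (hP : ∀ a, 0 ≤ P a)
    {U : Set (V × V → ℝ)} {f : L → X × Y → ℝ} {h : V × V → ℝ} {θ δ : ℝ}
    (hU : ∀ lam ∈ U, n * (∑ l, empirical cls l * cumulantBound (distQ (S l) lam) (f l) - θ) +
      k * (cumulantBound (fun ab => P ab.2) h - ∑ ab, lam ab * h ab) ≤ -(n * δ)) :
    𝔼 s : Network S cls k, ∑ v, ∑ v', (if jointType v v' ∈ U then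
        ∑ y, jointProb S P s v' y * Real.exp (score S f s v y - n * θ) else 0) ≤
      Real.exp (-(n * δ)) := by
  calc _ ≤ ∑ v : Fin k → V, ∑ v' : Fin k → V, Real.exp (-(n * δ)) * (priorProb P v' *
        Real.exp (k * (∑ ab, jointType v v' ab * h ab -
          cumulantBound (fun ab => P ab.2) h))) := by
        simp_rw [Finset.expect_sum_comm]
        refine Finset.sum_le_sum fun v _ => Finset.sum_le_sum fun v' _ => ?_
        split_ifs with hv
        · have hδ := hU _ hv
          simp_rw [sub_eq_add_neg (score S f _ v _)]
          refine (expect_jointProb_mul_exp_score_le S hP _ _ v v').trans ?_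
          rw [mul_left_comm, ← Real.exp_add]
          refine mul_le_mul_of_nonneg_left (Real.exp_le_exp.2 ?_) (priorProb_nonneg hP v')
          linear_combination hδ
        · simpa using mul_nonneg (Real.exp_nonneg _)
            (mul_nonneg (priorProb_nonneg hP v') (Real.exp_nonneg _))
    _ ≤ Real.exp (-(n * δ)) := by
        simp_rw [← Finset.mul_sum]
        exact mul_le_of_le_one_right (Real.exp_nonneg _) (sum_priorProb_snd_mul_exp_le_one hP h)

theorem meanConfusionProb_le_exp_of_exponents (S : L → SensorClass V X Y) {P : V → ℝ}
    (hP : P ∈ stdSimplex ℝ V) {U : Set (V × V → ℝ)} {f : L → X × Y → ℝ} {h : V × V → ℝ}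
    {θ t δ : ℝ} (ht : 0 ≤ t)
    (htrue : ∀ lam ∈ U, ∑ l, empirical cls l *
      cumulantBound (distP (S l) (fstMarginal lam)) (fun z => -t * f l z) + t * θ ≤ -δ)
    (hfalse : ∀ lam ∈ U, n * (∑ l, empirical cls l * cumulantBound (distQ (S l) lam) (f l) - θ) +
      k * (cumulantBound (fun ab => P ab.2) h - ∑ ab, lam ab * h ab) ≤ -(n * δ)) :
    meanConfusionProb S P cls k U ≤ 2 * Real.exp (-(n * δ)) := by
  refine (Finset.expect_le_expect fun s _ =>
    confusionProb_le_score S hP.1 s U f (n * θ) ht).trans ?_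
  rw [Finset.expect_add_distrib, two_mul]
  exact add_le_add (expect_true_score_le_exp S hP htrue) (expect_false_score_le_exp S hP.1 hfalse)

end RandomCoding

section LowerBound

variable {V X Y L : Type*} [Fintype V] [Fintype X] [DecidableEq X] [Fintype Y] [Fintype L]

theorem denominator_eq {P : V → ℝ} (hP : P ∈ stdSimplex ℝ V) {lam : V × V → ℝ}
    (hlam : lam ∈ stdSimplex ℝ (V × V)) (hac : ∀ ab : V × V, P ab.2 = 0 → lam ab = 0) :
    denominator P lam = ((-klSum lam (fun ab => P ab.2) / Real.log 2 : ℝ) : EReal) := by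
  have hac_snd : ∀ b, P b = 0 → sndMarginal lam b = 0 :=
    fun b hb => Finset.sum_eq_zero fun a _ => hac (a, b) hb
  have hkl := klSum_nonneg (sndMarginal_mem_stdSimplex hlam) hP hac_snd
  have hmarginal : ∑ ab, lam ab * Real.log (P ab.2) =
      ∑ b, sndMarginal lam b * Real.log (P b) := by
    simp_rw [Fintype.sum_prod_type_right, sndMarginal, Finset.sum_mul]
  rw [denominator, klDist_eq_ofReal hac_snd, EReal.coe_ennreal_ofReal,
    max_eq_left (by positivity), ← EReal.coe_sub, klSum_eq_sub hac_snd, klSum_eq_sub hac,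
    hmarginal]
  simp only [entropy, Real.logb, mul_div_assoc', ← Finset.sum_div]
  congr 1
  ring

theorem numerator_eq {S : L → SensorClass V X Y} {α : L → ℝ≥0} {P : V → ℝ} {lam : V × V → ℝ}
    (hkl : ∀ l, 0 ≤ α l * klSum (distP (S l) P) (distQ (S l) lam))
    (hac : ∀ l, α l ≠ 0 → ∀ z, distQ (S l) lam z = 0 → distP (S l) P z = 0) :
    numerator S α P lam =
      ENNReal.ofReal ((∑ l, α l * klSum (distP (S l) P) (distQ (S l) lam)) / Real.log 2) := by
  rw [numerator, Finset.sum_div, ENNReal.ofReal_sum_of_nonneg fun l _ =>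
    div_nonneg (hkl l) (Real.log_nonneg one_le_two)]
  refine Finset.sum_congr rfl fun l _ => ?_
  rcases eq_or_ne (α l) 0 with hl | hl
  · simp [hl]
  · rw [klDist_eq_ofReal (hac l hl), mul_div_assoc, ENNReal.ofReal_mul (NNReal.coe_nonneg _),
      ENNReal.ofReal_coe_nnreal]

theorem exists_pos_cumulantBound_add_mul_neg {S : L → SensorClass V X Y} {ν : L → ℝ} {P : V → ℝ}
    (hP : P ∈ stdSimplex ℝ V) {f : L → X × Y → ℝ} {θ : ℝ}
    (hθ : θ < ∑ l, ν l * ∑ z, distP (S l) P z * f l z) :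
    ∃ t > 0, ∑ l, ν l * cumulantBound (distP (S l) P) (fun z => -t * f l z) + t * θ < 0 := by
  obtain ⟨t, ht, hlt⟩ := exists_pos_sum_mul_exp_sub_one_lt
    (q := fun lz : L × (X × Y) => ν lz.1 * distP (S lz.1) P lz.2) (g := fun lz => -f lz.1 lz.2)
    (c := -θ) (by simpa [Fintype.sum_prod_type (α₁ := L), Finset.mul_sum, mul_assoc] using hθ)
  refine ⟨t, ht, ?_⟩
  simp_rw [Fintype.sum_prod_type (α₁ := L), mul_assoc, ← Finset.mul_sum] at hlt
  simp_rw [fun l => cumulantBound_eq_sum (distP_mem_stdSimplex (S l) hP).2, neg_mul, ← mul_neg]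
  linarith

variable [DecidableEq V]

theorem klSum_add_pos_of_lt_lowerBound {S : L → SensorClass V X Y} {α : L → ℝ≥0} {P : V → ℝ}
    (hP : P ∈ stdSimplex ℝ V) {D : ℝ} {R : ℝ≥0} (hR0 : 0 < R)
    (hR : (R : ℝ≥0∞) < lowerBound S α P D) {lam : V × V → ℝ} (hlam : lam ∈ feasible P D)
    (hacQ : ∀ l, α l ≠ 0 → ∀ z, distQ (S l) lam z = 0 → distP (S l) P z = 0)
    (hacP : ∀ ab : V × V, P ab.2 = 0 → lam ab = 0) :
    0 < ∑ l, α l * klSum (distP (S l) P) (distQ (S l) lam) +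
      R * klSum lam (fun ab => P ab.2) := by
  have hterm : ∀ l, 0 ≤ α l * klSum (distP (S l) P) (distQ (S l) lam) := fun l => by
    rcases eq_or_ne (α l) 0 with hl | hl
    · simp [hl]
    · exact mul_nonneg (α l).2 (klSum_nonneg (distP_mem_stdSimplex _ hP)
        (distQ_mem_stdSimplex _ hlam.1) (hacQ l hl))
  have hden := denominator_eq hP hlam.1 hacP
  have hnum := numerator_eq hterm hacQ
  set N := ∑ l, α l * klSum (distP (S l) P) (distQ (S l) lam)
  set d := klSum lam fun ab => P ab.2
  have hN : 0 ≤ N := Finset.sum_nonneg fun l _ => hterm l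
  have hR0' : (0 : ℝ) < R := hR0
  rcases lt_or_ge 0 d with hd | hd
  · positivity
  have hd' : 0 ≤ -d / Real.log 2 := div_nonneg (neg_nonneg.2 hd) (Real.log_nonneg one_le_two)
  have hratio : (R : ℝ≥0∞) < numerator S α P lam / (denominator P lam).toENNReal :=
    hR.trans_le (iInf₂_le_of_le lam hlam (iInf_le_of_le (by rw [hden]; exact_mod_cast hd') le_rfl))
  rw [hden, hnum, EReal.toENNReal_of_ne_top (EReal.coe_ne_top _), EReal.toReal_coe] at hratio
  have hmul := ENNReal.mul_lt_of_lt_div hratio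
  rw [← ENNReal.ofReal_coe_nnreal, ← ENNReal.ofReal_mul hR0'.le,
    ENNReal.ofReal_lt_ofReal_iff_of_nonneg (mul_nonneg hR0'.le hd'), ← mul_div_assoc,
    div_lt_div_iff_of_pos_right (Real.log_pos one_lt_two)] at hmul
  linarith

/-- The variational formula for the divergence trades it for moments of `f` and `h`, which are
continuous in `lam` and `α`; this form of the inequality needs no absolute continuity. -/
theorem exists_cumulantBound_lt_of_lt_lowerBound {S : L → SensorClass V X Y} {α : L → ℝ≥0}
    {P : V → ℝ} (hP : P ∈ stdSimplex ℝ V) {D : ℝ} {R : ℝ≥0} (hR0 : 0 < R)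
    (hR : (R : ℝ≥0∞) < lowerBound S α P D) {lam : V × V → ℝ} (hlam : lam ∈ feasible P D) :
    ∃ (f : L → X × Y → ℝ) (h : V × V → ℝ),
      ∑ l, α l * cumulantBound (distQ (S l) lam) (f l) +
          R * (cumulantBound (fun ab => P ab.2) h - ∑ ab, lam ab * h ab) <
        ∑ l, α l * ∑ z, distP (S l) P z * f l z := by
  let p : (L × (X × Y)) ⊕ (V × V) → ℝ :=
    Sum.elim (fun lz => α lz.1 * distP (S lz.1) P lz.2) fun ab => R * lam ab
  let q : (L × (X × Y)) ⊕ (V × V) → ℝ :=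
    Sum.elim (fun lz => α lz.1 * distQ (S lz.1) lam lz.2) fun ab => R * P ab.2
  have hscale : ∀ c a b : ℝ, c * a * Real.log (c * a / (c * b)) = c * (a * Real.log (a / b)) :=
    fun c a b => by
      rcases eq_or_ne c 0 with rfl | hc
      · simp
      · rw [mul_div_mul_left _ _ hc, mul_assoc]
  have hkl : klSum p q = ∑ l, α l * klSum (distP (S l) P) (distQ (S l) lam) +
      R * klSum lam (fun ab => P ab.2) := by
    simp only [klSum, p, q, Fintype.sum_sum_type, Sum.elim_inl, Sum.elim_inr, hscale,
      Fintype.sum_prod_type (α₁ := L), Finset.mul_sum]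
  have hPl := fun l => distP_mem_stdSimplex (S l) hP
  have hp : ∀ i, 0 ≤ p i := Sum.rec (fun lz => mul_nonneg (α lz.1).2 ((hPl lz.1).1 lz.2))
    fun ab => mul_nonneg R.2 (hlam.1.1 ab)
  have hq : ∀ i, 0 ≤ q i := Sum.rec (fun lz => mul_nonneg (α lz.1).2 (distQ_nonneg _ hlam.1.1 lz.2))
    fun ab => mul_nonneg R.2 (hP.1 ab.2)
  obtain ⟨F, hF⟩ := exists_lt_sum_of_lt_klSum hp hq (c := 0)
    fun hac => by
      rw [hkl]
      refine klSum_add_pos_of_lt_lowerBound hP hR0 hR hlam (fun l hl z hz => ?_) fun ab hab => ?_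
      · simpa [p, q, hl, hz] using hac (Sum.inl (l, z))
      · simpa [p, q, hR0.ne', hab] using hac (Sum.inr ab)
  refine ⟨fun l z => F (Sum.inl (l, z)), fun ab => F (Sum.inr ab), ?_⟩
  rw [Fintype.sum_sum_type, Fintype.sum_prod_type (α₁ := L)] at hF
  simp only [p, q, Sum.elim_inl, Sum.elim_inr, mul_assoc, ← mul_sub, ← mul_add, ← Finset.mul_sum,
    Finset.sum_add_distrib, Finset.sum_sub_distrib, (hPl _).2, hlam.1.2] at hF
  rw [← sub_pos]
  refine hF.trans_eq ?_
  simp only [cumulantBound, mul_sub, mul_add, Finset.sum_sub_distrib, Finset.sum_add_distrib]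
  ring

end LowerBound

section Achievability

variable {V X Y L : Type*} [Fintype V] [DecidableEq V] [Fintype Y]

theorem exists_nhds_tendsto_meanConfusionProb_of_fstMarginal_ne (S : L → SensorClass V X Y)
    {P : V → ℝ} (hP : P ∈ stdSimplex ℝ V) (cls : (n : ℕ) → Fin n → L) {k : ℕ → ℕ}
    (hk : Tendsto k atTop atTop) {lam : V × V → ℝ} (hlam : fstMarginal lam ≠ P) :
    ∃ U ∈ 𝓝 lam, Tendsto (fun n => meanConfusionProb S P (cls n) (k n) U) atTop (𝓝 0) := by
  obtain ⟨h, hh⟩ := exists_cumulantBound_lt_of_ne hP.2 hlam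
  obtain ⟨c, hc, hc0⟩ := exists_between (sub_neg.2 hh)
  have hcont : Continuous fun μ : V × V → ℝ =>
      cumulantBound P h - ∑ a, fstMarginal μ a * h a := by
    unfold fstMarginal
    fun_prop
  refine ⟨_, hcont.continuousAt.eventually_lt_const hc, ?_⟩
  have hlim : Tendsto (fun n => Real.exp (-(k n * -c))) atTop (𝓝 0) :=
    Real.tendsto_exp_neg_atTop_nhds_zero.comp
      ((tendsto_natCast_atTop_atTop.comp hk).atTop_mul_const (neg_pos.2 hc0))
  refine squeeze_zero (fun n => meanConfusionProb_nonneg S hP.1 _ _ _) (fun n => ?_) hlim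
  rcases isEmpty_or_nonempty (Network S (cls n) (k n)) with _ | _
  · simpa [meanConfusionProb] using Real.exp_nonneg _
  · refine Finset.expect_le Finset.univ_nonempty fun s _ =>
      confusionProb_le_exp_of_fstMarginal S hP.1 s (h := h) fun μ hμ => ?_
    rw [neg_neg]
    exact le_of_lt hμ

variable [Fintype X] [DecidableEq X] [Fintype L] [DecidableEq L]

theorem exists_nhds_tendsto_meanConfusionProb_of_exponents_neg (S : L → SensorClass V X Y)
    {P : V → ℝ} (hP : P ∈ stdSimplex ℝ V) {ν : L → ℝ} {cls : (n : ℕ) → Fin n → L}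
    (hcls : Tendsto (fun n => empirical (cls n)) atTop (𝓝 ν)) {k : ℕ → ℕ} {R : ℝ}
    (hk : Tendsto (fun n => (k n : ℝ) / n) atTop (𝓝 R)) {lam : V × V → ℝ}
    {f : L → X × Y → ℝ} {h : V × V → ℝ} {θ t : ℝ} (ht : 0 ≤ t)
    (htrue : ∑ l, ν l * cumulantBound (distP (S l) (fstMarginal lam)) (fun z => -t * f l z) +
      t * θ < 0)
    (hfalse : ∑ l, ν l * cumulantBound (distQ (S l) lam) (f l) - θ +
      R * (cumulantBound (fun ab => P ab.2) h - ∑ ab, lam ab * h ab) < 0) :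
    ∃ U ∈ 𝓝 lam, Tendsto (fun n => meanConfusionProb S P (cls n) (k n) U) atTop (𝓝 0) := by
  obtain ⟨c, hc, hc0⟩ := exists_between (max_lt htrue hfalse)
  obtain ⟨hctrue, hcfalse⟩ := max_lt_iff.1 hc
  have hcont_true : Continuous fun x : ((L → ℝ) × ℝ) × (V × V → ℝ) => ∑ l, x.1.1 l *
      cumulantBound (distP (S l) (fstMarginal x.2)) (fun z => -t * f l z) + t * θ := by
    refine (continuous_finsetSum _ fun l _ => Continuous.mul (by fun_prop) ?_).add_const _
    exact (continuous_cumulantBound_distP (S l) _).comp (by unfold fstMarginal; fun_prop)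
  have hcont_false : Continuous fun x : ((L → ℝ) × ℝ) × (V × V → ℝ) =>
      ∑ l, x.1.1 l * cumulantBound (distQ (S l) x.2) (f l) - θ +
        x.1.2 * (cumulantBound (fun ab => P ab.2) h - ∑ ab, x.2 ab * h ab) := by
    refine Continuous.add (Continuous.sub (continuous_finsetSum _ fun l _ =>
      Continuous.mul (by fun_prop) ?_) continuous_const) (by fun_prop)
    exact (continuous_cumulantBound_distQ (S l) _).comp continuous_snd
  have hev := (hcont_true.continuousAt (x := ((ν, R), lam)) |>.eventually_lt_const hctrue).and
    (hcont_false.continuousAt (x := ((ν, R), lam)) |>.eventually_lt_const hcfalse)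
  rw [nhds_prod_eq, eventually_prod_iff] at hev
  obtain ⟨isNear, hnear, inU, hU, hexponents⟩ := hev
  refine ⟨{μ | inU μ}, hU, ?_⟩
  have hlim : Tendsto (fun n : ℕ => 2 * Real.exp (-(n * -c))) atTop (𝓝 0) := by
    simpa using (Real.tendsto_exp_neg_atTop_nhds_zero.comp
      (tendsto_natCast_atTop_atTop.atTop_mul_const (neg_pos.2 hc0))).const_mul 2
  refine squeeze_zero' (Eventually.of_forall fun n => meanConfusionProb_nonneg S hP.1 _ _ _) ?_ hlim
  filter_upwards [(hcls.prodMk_nhds hk).eventually hnear, eventually_ne_atTop 0] with n hn hn0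
  refine meanConfusionProb_le_exp_of_exponents S hP (f := f) (h := h) (θ := θ) ht
    (fun μ hμ => ?_) fun μ hμ => ?_
  · simpa using (hexponents hn hμ).1.le
  · have hle := mul_le_mul_of_nonneg_left (hexponents hn hμ).2.le (Nat.cast_nonneg (α := ℝ) n)
    have hn0' : (n : ℝ) ≠ 0 := Nat.cast_ne_zero.2 hn0
    rw [mul_add, ← mul_assoc, mul_div_cancel₀ _ hn0'] at hle
    simpa using hle

theorem exists_nhds_tendsto_meanConfusionProb_of_mem_feasible {S : L → SensorClass V X Y}
    {P : V → ℝ} (hP : P ∈ stdSimplex ℝ V) {α : L → ℝ≥0} {cls : (n : ℕ) → Fin n → L}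
    (hcls : HasFrequencies cls α) {k : ℕ → ℕ} {R : ℝ≥0} (hR0 : 0 < R)
    (hk : Tendsto (fun n => (k n : ℝ) / n) atTop (𝓝 (R : ℝ))) {D : ℝ}
    (hR : (R : ℝ≥0∞) < lowerBound S α P D) {lam : V × V → ℝ} (hlam : lam ∈ feasible P D) :
    ∃ U ∈ 𝓝 lam, Tendsto (fun n => meanConfusionProb S P (cls n) (k n) U) atTop (𝓝 0) := by
  obtain ⟨f, h, hlt⟩ := exists_cumulantBound_lt_of_lt_lowerBound hP hR0 hR hlam
  obtain ⟨θ, hθfalse, hθtrue⟩ := exists_between hlt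
  obtain ⟨t, ht, htrue⟩ := exists_pos_cumulantBound_add_mul_neg hP hθtrue
  have hfst : fstMarginal lam = P := funext hlam.2.1
  have hfreq : Tendsto (fun n => empirical (cls n)) atTop (𝓝 fun l => (α l : ℝ)) :=
    tendsto_pi_nhds.2 fun l => by simpa only [empirical, Fintype.card_fin] using hcls l
  exact exists_nhds_tendsto_meanConfusionProb_of_exponents_neg S hP hfreq hk (f := f) (h := h)
    (θ := θ) ht.le (by rwa [hfst]) (by linarith)

theorem tendsto_meanConfusionProb {S : L → SensorClass V X Y} {P : V → ℝ}
    (hP : P ∈ stdSimplex ℝ V) {α : L → ℝ≥0} {cls : (n : ℕ) → Fin n → L}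
    (hcls : HasFrequencies cls α) {k : ℕ → ℕ} (hk : Tendsto k atTop atTop) {R : ℝ≥0}
    (hR0 : 0 < R) (hkR : Tendsto (fun n => (k n : ℝ) / n) atTop (𝓝 (R : ℝ))) {D : ℝ}
    (hR : (R : ℝ≥0∞) < lowerBound S α P D) :
    Tendsto (fun n => meanConfusionProb S P (cls n) (k n) (offDiagSet V D)) atTop (𝓝 0) := by
  refine IsCompact.induction_on (isCompact_offDiagSet D)
    (p := fun U => Tendsto (fun n => meanConfusionProb S P (cls n) (k n) U) atTop (𝓝 0))
    ?_ ?_ ?_ ?_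
  · simp [meanConfusionProb_empty]
  · exact fun U U' hU hU' => squeeze_zero (fun n => meanConfusionProb_nonneg S hP.1 _ _ _)
      (fun n => meanConfusionProb_mono S hP.1 _ _ hU) hU'
  · intro U U' hU hU'
    refine squeeze_zero (fun n => meanConfusionProb_nonneg S hP.1 _ _ _)
      (fun n => meanConfusionProb_union_le S hP.1 _ _ U U') ?_
    simpa using hU.add hU'
  · intro lam hlam
    obtain ⟨U, hU, hlim⟩ :
        ∃ U ∈ 𝓝 lam, Tendsto (fun n => meanConfusionProb S P (cls n) (k n) U) atTop (𝓝 0) := by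
      by_cases hfst : fstMarginal lam = P
      · exact exists_nhds_tendsto_meanConfusionProb_of_mem_feasible hP hcls hR0 hkR hR
          ⟨hlam.1, congrFun hfst, hlam.2⟩
      · exact exists_nhds_tendsto_meanConfusionProb_of_fstMarginal_ne S hP cls hk hfst
    exact ⟨U, mem_nhdsWithin_of_mem_nhds hU, hlim⟩

theorem achievable_of_lt_lowerBound {S : L → SensorClass V X Y} {P : V → ℝ}
    (hP : P ∈ stdSimplex ℝ V) {α : L → ℝ≥0} {cls : (n : ℕ) → Fin n → L}
    (hcls : HasFrequencies cls α) {R : ℝ≥0} (hR0 : 0 < R) {D : ℝ}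
    (hR : (R : ℝ≥0∞) < lowerBound S α P D) : Achievable S P D cls R := by
  have hR0' : (0 : ℝ) < R := hR0
  have hkR : Tendsto (fun n : ℕ => (⌈(n : ℝ) * R⌉₊ : ℝ) / n) atTop (𝓝 (R : ℝ)) := by
    simpa only [Function.comp_def, mul_comm] using
      (tendsto_nat_ceil_mul_div_atTop hR0'.le).comp (tendsto_natCast_atTop_atTop (R := ℝ))
  have hk : Tendsto (fun n : ℕ => ⌈(n : ℝ) * R⌉₊) atTop atTop :=
    tendsto_nat_ceil_atTop.comp (tendsto_natCast_atTop_atTop.atTop_mul_const hR0')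
  have hgood : ∀ n : ℕ, ∃ s : Network S (cls n) ⌈(n : ℝ) * R⌉₊,
      confusionProb S P s (offDiagSet V D) ≤
        meanConfusionProb S P (cls n) ⌈(n : ℝ) * R⌉₊ (offDiagSet V D) := by
    intro n
    have : Nonempty (Network S (cls n) ⌈(n : ℝ) * R⌉₊) :=
      ⟨fun ℓ _ => ⟨0, Nat.ceil_pos.2 (mul_pos (Nat.cast_pos.2 ℓ.pos) hR0')⟩⟩
    obtain ⟨s, -, hs⟩ := Finset.exists_le_of_expect_le Finset.univ_nonempty
      (le_refl (meanConfusionProb S P (cls n) ⌈(n : ℝ) * R⌉₊ (offDiagSet V D)))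
    exact ⟨s, hs⟩
  choose s hs using hgood
  refine ⟨s, fun g hg => squeeze_zero'
    (Eventually.of_forall fun n => errorProb_nonneg S hP.1 D _ _) ?_
    (tendsto_meanConfusionProb hP hcls hk hR0 hkR hR)⟩
  filter_upwards [hk.eventually_ne_atTop 0] with n hn
  exact (errorProb_le_confusionProb S hP.1 D hn (s n) (hg n)).trans (hs n)

end Achievability

end SensorNetwork

end

theorem mainTheorem7 {V X Y L : Type*}
    [Fintype V] [DecidableEq V] [Fintype X] [DecidableEq X] [Fintype Y]
    [Fintype L] [DecidableEq L]
    (S : L → SensorNetwork.SensorClass V X Y)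
    (α : L → ℝ≥0)
    (cls : (n : ℕ) → Fin n → L) (hcls : SensorNetwork.HasFrequencies cls α)
    (P : V → ℝ) (hP : P ∈ stdSimplex ℝ V)
    (D : ℝ) (hD : D ∈ Set.Icc (0 : ℝ) 1) :
    SensorNetwork.lowerBound S α P D ≤ SensorNetwork.sensingCapacity S P D cls := by
  refine le_of_forall_lt_imp_le_of_dense fun c hc => ?_
  lift c to ℝ≥0 using hc.ne_top
  refine le_iSup₂_of_le c (fun R hR0 hRc => ?_) le_rfl
  exact SensorNetwork.achievable_of_lt_lowerBound hP hcls hR0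
    ((ENNReal.coe_lt_coe.2 hRc).trans hc)
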